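/- Let $d\ge 1$ be an integer, $\nu>0$, $\sigma>0$ and $\gamma=\frac{1}{\sigma\sqrt2}$. Let $\mathbf X$ and $\mathbf T$ be independent random vectors in $\mathbb R^d$, where $\mathbf X$ is centered Gaussian with covariance matrix $\sigma^2 I_d$ and $\mathbf T$ is Student $t$-distributed with $2\nu$ degrees of freedom, i.e. $\mathbf T$ has the density \[ f_\nu(\mathbf t)=\frac{\Gamma(\nu+\frac d2)}{\Gamma(\nu)\,\pi^{d/2}}\left(1+\|\mathbf t\|^2\right)^{-\nu-\frac d2},\qquad \mathbf t\in\mathbb R^d . \] For $k=0,1,2,\dots$ put \[ \alpha_k^{(\nu,\gamma)}=\frac{\Gamma(k+\frac d2)}{k!\,\Gamma(\frac d2)\,\Gamma(\nu)}\,\gamma^{2k}\int_0^{\infty}e^{-a}a^{\nu+\frac d2-1}\left(a+\gamma^2\right)^{-k-\frac d2}\,da . \] For $r>0$ and $0<p<1$ let $NB(r,p)$ be the negative binomial distribution $\Pr\{B=k\}=\binom{k+r-1}{k}p^r(1-p)^k$, $k=0,1,\dots$, with the generalized binomial coefficient. Then $\alpha_k^{(\nu,\gamma)}>0$ for all $k$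 and $\sum_{k\ge0}\alpha_k^{(\nu,\gamma)}=1$. The probability distribution on $\{0,1,2,\dots\}$ with weights $\alpha_k^{(\nu,\gamma)}$ is the compound negative binomial distribution $NB\left(\frac d2,\frac a{1+a}\right)$ whose parameter $a$ is Gamma distributed with density $\frac{\gamma^{2\nu}}{\Gamma(\nu)}e^{-t\gamma^2}t^{\nu-1}$, $t>0$; that is, if $a$ has this density and, conditionally on $a$, $K$ has the distribution $NB\left(\frac d2,\frac a{1+a}\right)$, then $\Pr\{K=k\}=\alpha_k^{(\nu,\gamma)}$ for all $k$, and conversely every random variable $K$ with $\Pr\{K=k\}=\alpha_k^{(\nu,\gamma)}$ for all $k$ has this compound distribution. Moreover, let $K$ be a random variable with $\Pr\{K=k\}=\alpha_k^{(\nu,\gamma)}$, $k=0,1,\dots$, let $\mathbf U_d$ be uniformly distributed on the unit sphere of $\mathbb R^d$, and for every $k\ge0$ let $\mathbf X_{2k+d}$ be a Gaussian vector in $\mathbb R^{2k+d}$ with mean zero and identity covariance matrix, such that for every $k$ the variables $K$, $\mathbf X_{2k+d}$ and $\mathbf U_d$ are independent. Then \[ \mathbf X+\mathbf T\overset{d}{=}\sigma\,\|\mathbf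 X_{2K+d}\|\,\mathbf U_d . \] -/

import Mathlib

open MeasureTheory ProbabilityTheory

universe u v

noncomputable section

namespace StudentGaussian

/-- Density of the `d`-dimensional Student `t`-distribution with `2 ν` degrees of freedom,
`f_ν(t) = Γ(ν + d/2) / (Γ(ν) π^(d/2)) * (1 + ‖t‖²)^(-ν - d/2)`. -/
def studentPDF (d : ℕ) (ν : ℝ) (t : EuclideanSpace ℝ (Fin d)) : ℝ :=
  Real.Gamma (ν + d / 2) / (Real.Gamma ν * Real.pi ^ ((d : ℝ) / 2)) *
    (1 + ‖t‖ ^ 2) ^ (-ν - (d : ℝ) / 2)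

/-- The `d`-dimensional Student `t`-distribution with `2 ν` degrees of freedom. -/
def studentMeasure (d : ℕ) (ν : ℝ) : Measure (EuclideanSpace ℝ (Fin d)) :=
  volume.withDensity fun t => ENNReal.ofReal (studentPDF d ν t)

/-- The centered Gaussian distribution on `ℝ^d` with covariance matrix `σ² I_d`, that is,
the law of `σ N` with `N` standard Gaussian. -/
def isotropicGaussian (d : ℕ) (σ : ℝ) : Measure (EuclideanSpace ℝ (Fin d)) :=
  (stdGaussian (EuclideanSpace ℝ (Fin d))).map fun x => σ • x

/-- The uniform distribution on the unit sphere of `ℝ^d`, as a measure on `ℝ^d`: the surface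
measure of the sphere, normalized to total mass one. -/
def sphereUniform (d : ℕ) : Measure (EuclideanSpace ℝ (Fin d)) :=
  (((volume : Measure (EuclideanSpace ℝ (Fin d))).toSphere Set.univ)⁻¹ •
    (volume : Measure (EuclideanSpace ℝ (Fin d))).toSphere).map Subtype.val

/-- The probability weights `binom(k + r - 1, k) p^r (1 - p)^k` of the negative binomial
distribution `NB(r, p)`, `r > 0`, `0 < p < 1`, with the generalized binomial coefficient. -/
def negBinomialPMFReal (r p : ℝ) (k : ℕ) : ℝ :=
  Ring.choose ((k : ℝ) + r - 1) k * p ^ r * (1 - p) ^ k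

/-- The negative binomial distribution `NB(r, p)`, for `r > 0` and `0 < p < 1`. -/
def negBinomialMeasure (r p : ℝ) : Measure ℕ :=
  Measure.sum fun k : ℕ => ENNReal.ofReal (negBinomialPMFReal r p k) • Measure.dirac k

lemma measurable_negBinomialMeasure (r : ℝ) :
    Measurable fun a : ℝ => negBinomialMeasure r (a / (1 + a)) := by
  refine Measure.measurable_of_measurable_coe _ fun s hs => ?_
  simp only [negBinomialMeasure, Measure.sum_apply _ hs, Measure.smul_apply, smul_eq_mul,
    negBinomialPMFReal]
  fun_prop

/-- The transition kernel `a ↦ NB(r, a / (1 + a))`; only `a > 0` matters. -/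
def negBinomialKernel (r : ℝ) : Kernel ℝ ℕ where
  toFun a := negBinomialMeasure r (a / (1 + a))
  measurable' := measurable_negBinomialMeasure r

/-- The compound negative binomial distribution `NB(r, a / (1 + a))` whose parameter `a` is Gamma
distributed with density `t ↦ b^ν / Γ(ν) * e^(-t b) * t^(ν - 1)` on `t > 0`, that is, the law of
a random variable whose conditional law given `a` is `NB(r, a / (1 + a))`. -/
def compoundNegBinomial (r ν b : ℝ) : Measure ℕ :=
  (gammaMeasure ν b).bind (negBinomialKernel r)

/-- The mixing coefficients `α_k^(ν,γ)` in dimension `d`. -/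
def alphaCoeff (d : ℕ) (ν γ : ℝ) (k : ℕ) : ℝ :=
  Real.Gamma (k + d / 2) / (k.factorial * Real.Gamma (d / 2) * Real.Gamma ν) * γ ^ (2 * k) *
    ∫ a in Set.Ioi (0 : ℝ),
      Real.exp (-a) * a ^ (ν + d / 2 - 1) * (a + γ ^ 2) ^ (-(k : ℝ) - d / 2)

end StudentGaussian

end

noncomputable section

namespace StudentGaussian

open Real Set
open scoped ENNReal RealInnerProductSpace

/-! Write `precGaussian d b` for the Gaussian law with density proportional to `exp (-b ‖x‖²)`; X
has this law with b = γ². The Student law is a mixture: if `a` is Gamma(ν, 1) and T given `a` is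
`precGaussian d a`, then integrating out `a` is a Gamma integral that yields f_ν
(`lintegral_studentMeasure`). Given `a`, variances add, so X + T is `precGaussian d (γ² p)` with p =
a / (a + γ²) (`precGaussian_conv_precGaussian`).

An isotropic Gaussian is its norm times an independent uniform direction, so only norms need
comparing. Expanding `exp (γ² (1 - p) r²)` in powers of r² shows that the norm density for parameter
γ² p in dimension d is the NB(d/2, p) mixture of the norm densities for parameter γ² in dimensions
2k + d (`hasSum_negBinomial_mul_radialPDF`). Averaging the NB(d/2, p) weights over `a` gives α_k
(`ofReal_alphaCoeff`), and replacing `a` by γ² a turns p into a / (1 + a), the compound form.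

Laws are compared by integrating nonnegative measurable functions, so sums and integrals may be
exchanged by Tonelli. -/

/-! ### Isotropic Gaussians parametrized by half the precision -/

/-- Density of the centered Gaussian distribution on `ℝ^d` with covariance matrix
`(2 b)⁻¹ I_d`. -/
def precGaussianPDF (d : ℕ) (b : ℝ) (x : EuclideanSpace ℝ (Fin d)) : ℝ :=
  (b / π) ^ ((d : ℝ) / 2) * exp (-b * ‖x‖ ^ 2)

/-- The centered Gaussian distribution on `ℝ^d` with covariance matrix `(2 b)⁻¹ I_d`. -/
def precGaussian (d : ℕ) (b : ℝ) : Measure (EuclideanSpace ℝ (Fin d)) :=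
  volume.withDensity fun x => ENNReal.ofReal (precGaussianPDF d b x)

lemma precGaussianPDF_nonneg (d : ℕ) {b : ℝ} (hb : 0 < b) (x : EuclideanSpace ℝ (Fin d)) :
    0 ≤ precGaussianPDF d b x := by
  unfold precGaussianPDF
  positivity

@[fun_prop]
lemma measurable_precGaussianPDF (d : ℕ) :
    Measurable fun q : ℝ × EuclideanSpace ℝ (Fin d) => precGaussianPDF d q.1 q.2 := by
  unfold precGaussianPDF
  fun_prop

@[fun_prop]
lemma measurable_precGaussianPDF_right (d : ℕ) (b : ℝ) : Measurable (precGaussianPDF d b) := by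
  unfold precGaussianPDF
  fun_prop

lemma lintegral_precGaussian (d : ℕ) (b : ℝ) {f : EuclideanSpace ℝ (Fin d) → ℝ≥0∞}
    (hf : Measurable f) :
    ∫⁻ x, f x ∂(precGaussian d b) = ∫⁻ x, ENNReal.ofReal (precGaussianPDF d b x) * f x := by
  rw [precGaussian, lintegral_withDensity_eq_lintegral_mul _ (by fun_prop) hf]
  rfl

lemma isProbabilityMeasure_precGaussian (d : ℕ) {b : ℝ} (hb : 0 < b) :
    IsProbabilityMeasure (precGaussian d b) := by
  constructor
  have h := GaussianFourier.integral_rexp_neg_mul_sq_norm (V := EuclideanSpace ℝ (Fin d)) hb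
  have hpos : 0 < (π / b) ^ ((d : ℝ) / 2) := by positivity
  simp only [finrank_euclideanSpace, Fintype.card_fin] at h
  have hint : Integrable fun x : EuclideanSpace ℝ (Fin d) => exp (-b * ‖x‖ ^ 2) := by
    -- A non-integrable function has Bochner integral 0, so the positive value in `h` forces
    -- integrability.
    by_contra hc
    rw [integral_undef hc] at h
    exact hpos.ne h
  rw [precGaussian, withDensity_apply _ .univ, setLIntegral_univ,
    ← ofReal_integral_eq_lintegral_ofReal]
  · unfold precGaussianPDF
    rw [integral_const_mul, h, ← mul_rpow (by positivity) (by positivity)]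
    have : b / π * (π / b) = 1 := by field_simp
    simp [this]
  · exact hint.const_mul _
  · exact .of_forall fun x => precGaussianPDF_nonneg d hb x

lemma charFun_precGaussian (d : ℕ) {b : ℝ} (hb : 0 < b) (t : EuclideanSpace ℝ (Fin d)) :
    charFun (precGaussian d b) t = Complex.exp (((-‖t‖ ^ 2 / (4 * b) : ℝ) : ℂ)) := by
  have h := GaussianFourier.integral_cexp_neg_mul_sq_norm_add (b := (b : ℂ))
    (V := EuclideanSpace ℝ (Fin d)) (by simpa using hb) Complex.I t
  simp only [finrank_euclideanSpace, Fintype.card_fin] at h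
  rw [charFun_apply, precGaussian,
    integral_withDensity_eq_integral_toReal_smul (by fun_prop) (by simp)]
  have : ∀ x : EuclideanSpace ℝ (Fin d),
      (ENNReal.ofReal (precGaussianPDF d b x)).toReal • Complex.exp (⟪x, t⟫ * Complex.I) =
      (((b / π) ^ ((d : ℝ) / 2) : ℝ) : ℂ) *
        Complex.exp (-b * ‖x‖ ^ 2 + Complex.I * ⟪t, x⟫) := by
    intro x
    rw [ENNReal.toReal_ofReal (precGaussianPDF_nonneg d hb x), precGaussianPDF, Complex.exp_add,
      real_inner_comm, mul_comm Complex.I, Complex.real_smul]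
    push_cast
    ring
  simp_rw [this]
  rw [integral_const_mul, h]
  have hc : ((π : ℂ) / b) ^ ((d : ℂ) / 2) = (((π / b) ^ ((d : ℝ) / 2) : ℝ) : ℂ) := by
    rw [Complex.ofReal_cpow (by positivity)]
    push_cast
    rfl
  rw [hc, ← mul_assoc, ← Complex.ofReal_mul, ← mul_rpow (by positivity) (by positivity)]
  have : b / π * (π / b) = 1 := by field_simp
  rw [this]
  simp [neg_div]

lemma isotropicGaussian_eq_precGaussian (d : ℕ) {s : ℝ} (hs : 0 < s) :
    isotropicGaussian d s = precGaussian d (1 / (2 * s ^ 2)) := by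
  have := isProbabilityMeasure_precGaussian d (b := 1 / (2 * s ^ 2)) (by positivity)
  have : IsProbabilityMeasure (isotropicGaussian d s) :=
    Measure.isProbabilityMeasure_map (by fun_prop)
  apply Measure.ext_of_charFun
  ext t
  rw [charFun_precGaussian d (by positivity), isotropicGaussian, charFun_map_smul,
    charFun_stdGaussian]
  congr 1
  rw [norm_smul, norm_of_nonneg hs.le]
  push_cast
  have : (s : ℂ) ≠ 0 := by exact_mod_cast hs.ne'
  field_simp
  ring

/-- Variances 1/(2a) and 1/(2b) add. The parameter is written as `b` times a / (a + b) because that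
factor becomes the negative binomial success probability. -/
lemma precGaussian_conv_precGaussian (d : ℕ) {a b : ℝ} (ha : 0 < a) (hb : 0 < b) :
    (precGaussian d a).conv (precGaussian d b) = precGaussian d (b * (a / (a + b))) := by
  have := isProbabilityMeasure_precGaussian d ha
  have := isProbabilityMeasure_precGaussian d hb
  have := isProbabilityMeasure_precGaussian d (b := b * (a / (a + b))) (by positivity)
  apply Measure.ext_of_charFun
  ext t
  rw [charFun_conv, charFun_precGaussian d ha, charFun_precGaussian d hb,
    charFun_precGaussian d (by positivity), ← Complex.exp_add, ← Complex.ofReal_add]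
  congr 2
  field_simp
  ring

/-! ### Polar coordinates and the norm of a Gaussian vector -/

section Polar

variable {d : ℕ}

lemma toSphere_univ (hd : 1 ≤ d) :
    (volume : Measure (EuclideanSpace ℝ (Fin d))).toSphere univ =
      ENNReal.ofReal (2 * π ^ ((d : ℝ) / 2) / Gamma ((d : ℝ) / 2)) := by
  have : Nonempty (Fin d) := ⟨⟨0, hd⟩⟩
  have hd' : (0 : ℝ) < d := by exact_mod_cast hd
  rw [Measure.toSphere_apply_univ, EuclideanSpace.volume_ball]
  simp only [finrank_euclideanSpace, Fintype.card_fin, ENNReal.ofReal_one, one_pow, one_mul]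
  rw [← ENNReal.ofReal_natCast, ← ENNReal.ofReal_mul (by positivity), Gamma_add_one (by positivity),
    sqrt_eq_rpow, ← rpow_natCast, ← rpow_mul pi_pos.le]
  congr 1
  have : Gamma ((d : ℝ) / 2) ≠ 0 := (Gamma_pos_of_pos (by positivity)).ne'
  field_simp

lemma toSphere_univ_ne_zero (hd : 1 ≤ d) :
    (volume : Measure (EuclideanSpace ℝ (Fin d))).toSphere univ ≠ 0 := by
  have hd' : (0 : ℝ) < d := by exact_mod_cast hd
  have : 0 < Gamma ((d : ℝ) / 2) := Gamma_pos_of_pos (by positivity)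
  rw [toSphere_univ hd]
  exact (ENNReal.ofReal_pos.2 (by positivity)).ne'

lemma isProbabilityMeasure_sphereUniform (hd : 1 ≤ d) :
    IsProbabilityMeasure (sphereUniform d) := by
  constructor
  rw [sphereUniform, Measure.map_apply measurable_subtype_coe .univ, preimage_univ,
    Measure.smul_apply, smul_eq_mul]
  exact ENNReal.inv_mul_cancel (toSphere_univ_ne_zero hd) (measure_ne_top _ _)

lemma lintegral_eq_lintegral_sphereUniform (hd : 1 ≤ d)
    {f : EuclideanSpace ℝ (Fin d) → ℝ≥0∞} (hf : Measurable f) :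
    ∫⁻ x, f x = ENNReal.ofReal (2 * π ^ ((d : ℝ) / 2) / Gamma ((d : ℝ) / 2)) *
      ∫⁻ u, (∫⁻ r in Ioi (0 : ℝ), ENNReal.ofReal (r ^ (d - 1)) * f (r • u)) ∂(sphereUniform d) := by
  have : Nonempty (Fin d) := ⟨⟨0, hd⟩⟩
  have : Nontrivial (EuclideanSpace ℝ (Fin d)) :=
    Module.nontrivial_of_finrank_pos (R := ℝ) (by simp; omega)
  have hm : Measurable fun u : EuclideanSpace ℝ (Fin d) =>
      ∫⁻ r in Ioi (0 : ℝ), ENNReal.ofReal (r ^ (d - 1)) * f (r • u) :=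
    Measurable.lintegral_prod_right' (f := fun q : EuclideanSpace ℝ (Fin d) × ℝ =>
      ENNReal.ofReal (q.2 ^ (d - 1)) * f (q.2 • q.1)) (by fun_prop)
  rw [← toSphere_univ hd, sphereUniform, lintegral_map hm measurable_subtype_coe,
    lintegral_smul_measure, smul_eq_mul, ← mul_assoc,
    ENNReal.mul_inv_cancel (toSphere_univ_ne_zero hd) (measure_ne_top _ _), one_mul]
  have hpres := (volume : Measure (EuclideanSpace ℝ (Fin d))).measurePreserving_homeomorphUnitSphereProd
  let e := homeomorphUnitSphereProd (EuclideanSpace ℝ (Fin d))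
  calc ∫⁻ x, f x
      = ∫⁻ x in ({0}ᶜ : Set (EuclideanSpace ℝ (Fin d))), f x := by
        rw [Measure.restrict_eq_self_of_ae_mem]
        -- The polar homeomorphism is defined only off the origin, which is a null set.
        exact compl_mem_ae_iff.2 (measure_singleton 0)
    _ = ∫⁻ x : ({0}ᶜ : Set (EuclideanSpace ℝ (Fin d))), f x ∂(volume.comap Subtype.val) :=
        (lintegral_subtype_comap (measurableSet_singleton _).compl f).symm
    _ = ∫⁻ q, f (q.2.1 • q.1.1) ∂((volume : Measure (EuclideanSpace ℝ (Fin d))).toSphere.prod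
          (Measure.volumeIoiPow (Module.finrank ℝ (EuclideanSpace ℝ (Fin d)) - 1))) := by
        rw [← hpres.lintegral_comp (by fun_prop)]
        refine lintegral_congr fun x => ?_
        have : x = e.symm (e x) := (e.symm_apply_apply x).symm
        conv_lhs => rw [this]
        rw [homeomorphUnitSphereProd_symm_apply_coe]
    _ = _ := by
        rw [lintegral_prod _ (by fun_prop), finrank_euclideanSpace, Fintype.card_fin]
        refine lintegral_congr fun u => ?_
        rw [Measure.volumeIoiPow, lintegral_withDensity_eq_lintegral_mul _ (by fun_prop)
          (by fun_prop)]
        exact lintegral_subtype_comap measurableSet_Ioi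
          fun r : ℝ => ENNReal.ofReal (r ^ (d - 1)) * f (r • u.1)

lemma norm_eq_one_ae_sphereUniform : ∀ᵐ u ∂(sphereUniform d), ‖u‖ = 1 := by
  rw [sphereUniform, ae_map_iff (by fun_prop) (measurableSet_eq_fun (by fun_prop) (by fun_prop))]
  exact .of_forall fun u => by simp

/-- Density of the norm of a `precGaussian d b` random vector. -/
def radialPDF (d : ℕ) (b r : ℝ) : ℝ :=
  2 * b ^ ((d : ℝ) / 2) / Gamma ((d : ℝ) / 2) * r ^ (d - 1) * exp (-b * r ^ 2)

lemma lintegral_precGaussian_eq_sphereUniform (hd : 1 ≤ d) {b : ℝ} (hb : 0 < b)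
    {f : EuclideanSpace ℝ (Fin d) → ℝ≥0∞} (hf : Measurable f) :
    ∫⁻ x, f x ∂(precGaussian d b) =
      ∫⁻ u, (∫⁻ r in Ioi (0 : ℝ), ENNReal.ofReal (radialPDF d b r) * f (r • u))
        ∂(sphereUniform d) := by
  have hd' : (0 : ℝ) < d := by exact_mod_cast hd
  have hG : 0 < Gamma ((d : ℝ) / 2) := Gamma_pos_of_pos (by positivity)
  rw [lintegral_precGaussian d b hf, lintegral_eq_lintegral_sphereUniform hd (by fun_prop),
    ← lintegral_const_mul' _ _ ENNReal.ofReal_ne_top]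
  refine lintegral_congr_ae ?_
  filter_upwards [norm_eq_one_ae_sphereUniform] with u hu
  rw [← lintegral_const_mul' _ _ ENNReal.ofReal_ne_top]
  refine setLIntegral_congr_fun measurableSet_Ioi fun r (hr : 0 < r) => ?_
  rw [← mul_assoc, ← mul_assoc, ← ENNReal.ofReal_mul (by positivity),
    ← ENNReal.ofReal_mul (by positivity)]
  congr 2
  rw [precGaussianPDF, radialPDF, norm_smul, hu, mul_one, norm_of_nonneg hr.le,
    div_rpow hb.le pi_pos.le]
  have : π ^ ((d : ℝ) / 2) ≠ 0 := by positivity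
  field_simp

lemma lintegral_norm_precGaussian (hd : 1 ≤ d) {b : ℝ} (hb : 0 < b) {h : ℝ → ℝ≥0∞}
    (hh : Measurable h) :
    ∫⁻ x, h ‖x‖ ∂(precGaussian d b) =
      ∫⁻ r in Ioi (0 : ℝ), ENNReal.ofReal (radialPDF d b r) * h r := by
  have := isProbabilityMeasure_sphereUniform hd
  rw [lintegral_precGaussian_eq_sphereUniform hd hb (by fun_prop)]
  trans ∫⁻ _, (∫⁻ r in Ioi (0 : ℝ), ENNReal.ofReal (radialPDF d b r) * h r) ∂(sphereUniform d)
  · refine lintegral_congr_ae ?_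
    filter_upwards [norm_eq_one_ae_sphereUniform] with u hu
    refine setLIntegral_congr_fun measurableSet_Ioi fun r (hr : 0 < r) => ?_
    simp only [norm_smul, hu, mul_one, norm_of_nonneg hr.le]
  · simp

/-- By rotation invariance, norm and direction are independent and the direction is uniform. -/
lemma lintegral_precGaussian_eq_norm_smul (hd : 1 ≤ d) {b : ℝ} (hb : 0 < b)
    {f : EuclideanSpace ℝ (Fin d) → ℝ≥0∞} (hf : Measurable f) :
    ∫⁻ x, f x ∂(precGaussian d b) =
      ∫⁻ u, ∫⁻ x, f (‖x‖ • u) ∂(precGaussian d b) ∂(sphereUniform d) := by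
  rw [lintegral_precGaussian_eq_sphereUniform hd hb hf]
  refine lintegral_congr fun u => ?_
  rw [lintegral_norm_precGaussian hd hb (h := fun r => f (r • u)) (by fun_prop)]

end Polar

/-! ### Negative binomial mixtures of Gaussian norms -/

section NegBinomial

lemma factorial_mul_choose_mul_Gamma {r : ℝ} (hr : 0 < r) (k : ℕ) :
    k.factorial * Ring.choose ((k : ℝ) + r - 1) k * Gamma r = Gamma (k + r) := by
  have h : (k.factorial : ℝ) * Ring.choose ((k : ℝ) + r - 1) k = (ascPochhammer ℝ k).eval r := by
    have := Ring.factorial_nsmul_multichoose_eq_ascPochhammer r k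
    rwa [Ring.multichoose_eq, nsmul_eq_mul, Polynomial.ascPochhammer_smeval_eq_eval, add_comm r] at this
  rw [h]
  clear h
  induction k with
  | zero => simp
  | succ k ih =>
    rw [ascPochhammer_succ_eval, Nat.cast_succ, add_right_comm, Gamma_add_one (by positivity), ← ih]
    ring

lemma negBinomialPMFReal_eq {r : ℝ} (hr : 0 < r) (p : ℝ) (k : ℕ) :
    negBinomialPMFReal r p k =
      Gamma (k + r) / (k.factorial * Gamma r) * p ^ r * (1 - p) ^ k := by
  have hG := (Gamma_pos_of_pos hr).ne'
  rw [negBinomialPMFReal, ← factorial_mul_choose_mul_Gamma hr]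
  field_simp

lemma negBinomialPMFReal_nonneg {r p : ℝ} (hr : 0 < r) (hp : 0 < p) (hp1 : p < 1) (k : ℕ) :
    0 ≤ negBinomialPMFReal r p k := by
  have := sub_pos.2 hp1
  have := Gamma_pos_of_pos hr
  have : 0 < Gamma (k + r) := Gamma_pos_of_pos (by positivity)
  rw [negBinomialPMFReal_eq hr]
  positivity

lemma radialPDF_nonneg {d : ℕ} (hd : 1 ≤ d) {b r : ℝ} (hb : 0 < b) (hr : 0 < r) :
    0 ≤ radialPDF d b r := by
  have hd' : (0 : ℝ) < d := by exact_mod_cast hd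
  have hG : 0 < Gamma ((d : ℝ) / 2) := Gamma_pos_of_pos (by positivity)
  unfold radialPDF
  positivity

/-- The factor Γ(k + d/2) of the weight cancels the normalization of the norm density in dimension
2k + d. What remains is the exponential series of b (1 - p) r². -/
lemma hasSum_negBinomial_mul_radialPDF {d : ℕ} (hd : 1 ≤ d) {b p r : ℝ} (hb : 0 < b)
    (hp : 0 < p) (hr : 0 < r) :
    HasSum (fun k : ℕ => negBinomialPMFReal ((d : ℝ) / 2) p k * radialPDF (2 * k + d) b r)
      (radialPDF d (b * p) r) := by
  have hd' : (0 : ℝ) < d := by exact_mod_cast hd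
  have hG : 0 < Gamma ((d : ℝ) / 2) := Gamma_pos_of_pos (by positivity)
  have h := NormedSpace.expSeries_div_hasSum_exp (b * (1 - p) * r ^ 2)
  rw [← exp_eq_exp_ℝ] at h
  have key : (fun k : ℕ => negBinomialPMFReal ((d : ℝ) / 2) p k * radialPDF (2 * k + d) b r) =
      fun k : ℕ => 2 * (b * p) ^ ((d : ℝ) / 2) / Gamma ((d : ℝ) / 2) * r ^ (d - 1) *
        exp (-b * r ^ 2) * ((b * (1 - p) * r ^ 2) ^ k / k.factorial) := by
    funext k
    have hGk : 0 < Gamma ((k : ℝ) + (d : ℝ) / 2) := Gamma_pos_of_pos (by positivity)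
    have e1 : (((2 * k + d : ℕ) : ℝ)) / 2 = k + (d : ℝ) / 2 := by push_cast; ring
    -- The subtraction is truncated; this needs `1 ≤ d`.
    have e2 : 2 * k + d - 1 = 2 * k + (d - 1) := by omega
    rw [negBinomialPMFReal_eq (by positivity), radialPDF, e1, e2, rpow_add hb, rpow_natCast,
      mul_rpow hb.le hp.le, pow_add, pow_mul, mul_pow, mul_pow]
    field_simp
  have hsum : radialPDF d (b * p) r = 2 * (b * p) ^ ((d : ℝ) / 2) / Gamma ((d : ℝ) / 2) *
      r ^ (d - 1) * exp (-b * r ^ 2) * exp (b * (1 - p) * r ^ 2) := by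
    rw [radialPDF, mul_assoc _ (exp _), ← exp_add]
    ring_nf
  rw [key, hsum]
  exact h.mul_left _

lemma tsum_negBinomial_mul_lintegral_norm {d : ℕ} (hd : 1 ≤ d) {b p : ℝ} (hb : 0 < b)
    (hp : 0 < p) (hp1 : p < 1) {h : ℝ → ℝ≥0∞} (hh : Measurable h) :
    ∑' k : ℕ, ENNReal.ofReal (negBinomialPMFReal ((d : ℝ) / 2) p k) *
      ∫⁻ x, h ‖x‖ ∂(precGaussian (2 * k + d) b) = ∫⁻ x, h ‖x‖ ∂(precGaussian d (b * p)) := by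
  have hd' : (0 : ℝ) < d := by exact_mod_cast hd
  have hnb := negBinomialPMFReal_nonneg (r := (d : ℝ) / 2) (by positivity) hp hp1
  rw [lintegral_norm_precGaussian hd (by positivity) hh]
  have hmeas : ∀ n : ℕ, Measurable (radialPDF n b) := fun n => by unfold radialPDF; fun_prop
  calc _ = ∑' k : ℕ, ∫⁻ r in Ioi (0 : ℝ),
        ENNReal.ofReal (negBinomialPMFReal ((d : ℝ) / 2) p k) *
          (ENNReal.ofReal (radialPDF (2 * k + d) b r) * h r) := by
        refine tsum_congr fun k => ?_
        rw [lintegral_norm_precGaussian (by omega) hb hh,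
          lintegral_const_mul' _ _ ENNReal.ofReal_ne_top]
    _ = ∫⁻ r in Ioi (0 : ℝ), ∑' k : ℕ,
        ENNReal.ofReal (negBinomialPMFReal ((d : ℝ) / 2) p k) *
          (ENNReal.ofReal (radialPDF (2 * k + d) b r) * h r) := by
        rw [lintegral_tsum]
        intro k
        have := hmeas (2 * k + d)
        fun_prop
    _ = _ := by
        refine setLIntegral_congr_fun measurableSet_Ioi fun r (hr : 0 < r) => ?_
        have hs := hasSum_negBinomial_mul_radialPDF hd hb hp hr
        have hrad := fun k : ℕ => radialPDF_nonneg (d := 2 * k + d) (by omega) hb hr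
        rw [← hs.tsum_eq, ENNReal.ofReal_tsum_of_nonneg
          (fun k => mul_nonneg (hnb k) (hrad k)) hs.summable, ← ENNReal.tsum_mul_right]
        refine tsum_congr fun k => ?_
        rw [ENNReal.ofReal_mul (hnb k), mul_assoc]

/-- This is the mixture identity tested on the constant function 1: all the Gaussians involved have
mass one. -/
lemma tsum_negBinomial {d : ℕ} (hd : 1 ≤ d) {p : ℝ} (hp : 0 < p) (hp1 : p < 1) :
    ∑' k : ℕ, ENNReal.ofReal (negBinomialPMFReal ((d : ℝ) / 2) p k) = 1 := by
  have := isProbabilityMeasure_precGaussian d hp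
  have := fun k : ℕ => isProbabilityMeasure_precGaussian (2 * k + d) one_pos
  simpa using tsum_negBinomial_mul_lintegral_norm hd one_pos hp hp1 (h := fun _ => 1) (by fun_prop)

end NegBinomial

/-! ### The Student law as a Gamma mixture of Gaussians -/

section GammaMixture

lemma integrableOn_rpow_mul_exp_neg {s r : ℝ} (hs : 0 < s) (hr : 0 < r) :
    IntegrableOn (fun t : ℝ => t ^ (s - 1) * exp (-(r * t))) (Ioi 0) := by
  have h := integral_rpow_mul_exp_neg_mul_Ioi hs hr
  by_contra hc
  rw [integral_undef hc] at h
  have := Gamma_pos_of_pos hs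
  exact (by positivity : 0 < (1 / r) ^ s * Gamma s).ne h

lemma lintegral_rpow_mul_exp_neg {s r : ℝ} (hs : 0 < s) (hr : 0 < r) :
    ∫⁻ t in Ioi (0 : ℝ), ENNReal.ofReal (t ^ (s - 1) * exp (-(r * t))) =
      ENNReal.ofReal ((1 / r) ^ s * Gamma s) := by
  rw [← integral_rpow_mul_exp_neg_mul_Ioi hs hr,
    ofReal_integral_eq_lintegral_ofReal (integrableOn_rpow_mul_exp_neg hs hr)]
  filter_upwards [ae_restrict_mem measurableSet_Ioi] with t (ht : 0 < t)
  positivity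

lemma lintegral_gammaMeasure {ν b : ℝ} {f : ℝ → ℝ≥0∞} (hf : Measurable f) :
    ∫⁻ a, f a ∂(gammaMeasure ν b) = ∫⁻ a, gammaPDF ν b a * f a := by
  have : Measurable (gammaPDF ν b) := (measurable_gammaPDFReal ν b).ennreal_ofReal
  rw [gammaMeasure, lintegral_withDensity_eq_lintegral_mul _ this hf]
  rfl

lemma lintegral_gammaMeasure_eq_setLIntegral {ν b : ℝ} {f : ℝ → ℝ≥0∞} (hf : Measurable f) :
    ∫⁻ a, f a ∂(gammaMeasure ν b) = ∫⁻ a in Ioi (0 : ℝ),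
      ENNReal.ofReal (b ^ ν / Gamma ν * a ^ (ν - 1) * exp (-(b * a))) * f a := by
  rw [lintegral_gammaMeasure hf, ← setLIntegral_univ, ← Iio_union_Ici (a := (0 : ℝ)),
    lintegral_union measurableSet_Ici (by simp [disjoint_left]),
    setLIntegral_congr_fun (g := fun _ => 0) measurableSet_Iio
      (fun a ha => by simp [gammaPDF_of_neg (mem_Iio.1 ha)]), lintegral_zero, zero_add,
    setLIntegral_congr (Ioi_ae_eq_Ici (a := (0 : ℝ))).symm]
  refine setLIntegral_congr_fun measurableSet_Ioi fun a (ha : 0 < a) => ?_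
  rw [gammaPDF_of_nonneg ha.le]

lemma ae_pos_gammaMeasure (ν b : ℝ) : ∀ᵐ a ∂(gammaMeasure ν b), 0 < a := by
  have h := lintegral_gammaMeasure_eq_setLIntegral (ν := ν) (b := b)
    (f := (Iic (0 : ℝ)).indicator 1) (measurable_one.indicator measurableSet_Iic)
  rw [lintegral_indicator_one measurableSet_Iic,
    setLIntegral_congr_fun (g := fun _ => 0) measurableSet_Ioi
      (fun a ha => by simp [indicator_of_notMem (notMem_Iic.2 (mem_Ioi.1 ha))]),
    lintegral_zero] at h
  rw [ae_iff]
  simpa [Iic_def] using h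

/-- A Gamma variable of rate `b` is b⁻¹ times one of rate 1. This links the rate γ² of the compound
law to the rate 1 in α_k. -/
lemma lintegral_gammaMeasure_eq_one_rate {ν b : ℝ} (hb : 0 < b) {f : ℝ → ℝ≥0∞}
    (hf : Measurable f) :
    ∫⁻ t, f t ∂(gammaMeasure ν b) = ∫⁻ a, f (b⁻¹ * a) ∂(gammaMeasure ν 1) := by
  have hm : ∀ c : ℝ, Measurable (gammaPDF ν c) :=
    fun c => (measurable_gammaPDFReal ν c).ennreal_ofReal
  have hmap := Real.map_volume_mul_left (a := b⁻¹) (by positivity)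
  rw [inv_inv, abs_of_pos hb] at hmap
  have hmb := hm b
  have h : ∫⁻ t, gammaPDF ν b t * f t =
      ENNReal.ofReal b⁻¹ * ∫⁻ a, gammaPDF ν b (b⁻¹ * a) * f (b⁻¹ * a) := by
    rw [← lintegral_map (f := fun t => gammaPDF ν b t * f t) (g := fun a => b⁻¹ * a)
      (by fun_prop) (by fun_prop), hmap, lintegral_smul_measure, smul_eq_mul, ← mul_assoc,
      ← ENNReal.ofReal_mul (by positivity), inv_mul_cancel₀ hb.ne', ENNReal.ofReal_one, one_mul]
  rw [lintegral_gammaMeasure hf, lintegral_gammaMeasure (by fun_prop), h,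
    ← lintegral_const_mul' _ _ ENNReal.ofReal_ne_top]
  refine lintegral_congr fun a => ?_
  rw [← mul_assoc]
  congr 1
  rw [gammaPDF, gammaPDF, ← ENNReal.ofReal_mul (by positivity)]
  congr 1
  have hiff : 0 ≤ b⁻¹ * a ↔ 0 ≤ a := mul_nonneg_iff_of_pos_left (by positivity)
  rw [gammaPDFReal, gammaPDFReal]
  by_cases ha : 0 ≤ a
  · rw [if_pos ha, if_pos (hiff.2 ha), mul_rpow (by positivity) ha, inv_rpow hb.le,
      rpow_sub_one hb.ne']
    have : b ^ ν ≠ 0 := by positivity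
    field_simp
    simp
  · rw [if_neg ha, if_neg (hiff.not.2 ha), mul_zero]

lemma lintegral_studentMeasure (d : ℕ) {ν : ℝ} (hν : 0 < ν)
    {f : EuclideanSpace ℝ (Fin d) → ℝ≥0∞} (hf : Measurable f) :
    ∫⁻ x, f x ∂(studentMeasure d ν) =
      ∫⁻ a, (∫⁻ x, f x ∂(precGaussian d a)) ∂(gammaMeasure ν 1) := by
  have hG := Gamma_pos_of_pos hν
  have hstudent : Measurable fun t => ENNReal.ofReal (studentPDF d ν t) := by
    unfold studentPDF
    fun_prop
  simp_rw [lintegral_precGaussian d _ hf]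
  rw [studentMeasure, lintegral_withDensity_eq_lintegral_mul _ hstudent hf,
    lintegral_gammaMeasure_eq_setLIntegral (Measurable.lintegral_prod_right'
      (f := fun q : ℝ × EuclideanSpace ℝ (Fin d) =>
        ENNReal.ofReal (precGaussianPDF d q.1 q.2) * f q.2) (by fun_prop))]
  simp_rw [← lintegral_const_mul' _ _ ENNReal.ofReal_ne_top]
  rw [lintegral_lintegral_swap (by fun_prop)]
  refine lintegral_congr fun x => ?_
  rw [Pi.mul_apply]
  simp_rw [← mul_assoc]
  rw [lintegral_mul_const _ (by fun_prop)]
  congr 1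
  have hr : 0 < 1 + ‖x‖ ^ 2 := by positivity
  -- The Gaussian normalization contributes a^(d/2), raising the Gamma shape to ν + d/2, and its
  -- exponential raises the rate to 1 + ‖x‖².
  trans ENNReal.ofReal ((Gamma ν * π ^ ((d : ℝ) / 2))⁻¹) *
    ∫⁻ a in Ioi (0 : ℝ), ENNReal.ofReal (a ^ (ν + d / 2 - 1) * exp (-((1 + ‖x‖ ^ 2) * a)))
  · rw [lintegral_rpow_mul_exp_neg (by positivity) hr, ← ENNReal.ofReal_mul (by positivity),
      studentPDF, one_div, inv_rpow hr.le, ← rpow_neg hr.le]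
    congr 1
    ring_nf
  · rw [← lintegral_const_mul' _ _ ENNReal.ofReal_ne_top]
    refine setLIntegral_congr_fun measurableSet_Ioi fun a (ha : 0 < a) => ?_
    rw [← ENNReal.ofReal_mul (by positivity), ← ENNReal.ofReal_mul (by positivity)]
    congr 1
    have he : exp (-((1 + ‖x‖ ^ 2) * a)) = exp (-(1 * a)) * exp (-a * ‖x‖ ^ 2) := by
      rw [← exp_add]
      ring_nf
    rw [precGaussianPDF, he, div_rpow ha.le pi_pos.le, one_rpow,
      show ν + d / 2 - 1 = (ν - 1) + (d : ℝ) / 2 by ring, rpow_add ha]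
    have : π ^ ((d : ℝ) / 2) ≠ 0 := by positivity
    field_simp

end GammaMixture

/-! ### The coefficients as averaged negative binomial weights -/

section AlphaCoeff

variable {d : ℕ} {ν γ : ℝ}

lemma integrableOn_alphaCoeff (hν : 0 < ν) (hγ : 0 < γ) (k : ℕ) :
    IntegrableOn (fun a : ℝ =>
      exp (-a) * a ^ (ν + d / 2 - 1) * (a + γ ^ 2) ^ (-(k : ℝ) - d / 2)) (Ioi 0) := by
  -- The exponent of a + γ² is nonpositive, so that factor is at most its value at a = 0, leaving a
  -- Gamma integrand.
  have h := (integrableOn_rpow_mul_exp_neg (s := ν + d / 2) (by positivity) one_pos).mul_const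
    ((γ ^ 2) ^ (-(k : ℝ) - d / 2))
  refine Integrable.mono' h (by fun_prop) ?_
  filter_upwards [ae_restrict_mem measurableSet_Ioi] with a (ha : 0 < a)
  have hle : (a + γ ^ 2) ^ (-(k : ℝ) - d / 2) ≤ (γ ^ 2) ^ (-(k : ℝ) - d / 2) :=
    rpow_le_rpow_of_nonpos (by positivity) (by linarith)
      (by linarith [show (0 : ℝ) ≤ k by positivity, show (0 : ℝ) ≤ (d : ℝ) / 2 by positivity])
  rw [norm_of_nonneg (by positivity), one_mul, mul_comm (exp _)]
  gcongr

lemma alphaCoeff_pos (hd : 1 ≤ d) (hν : 0 < ν) (hγ : 0 < γ) (k : ℕ) :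
    0 < alphaCoeff d ν γ k := by
  have hd' : (0 : ℝ) < d := by exact_mod_cast hd
  have := Gamma_pos_of_pos hν
  have : 0 < Gamma ((d : ℝ) / 2) := Gamma_pos_of_pos (by positivity)
  have : 0 < Gamma ((k : ℝ) + d / 2) := Gamma_pos_of_pos (by positivity)
  have hint : 0 < ∫ a in Ioi (0 : ℝ),
      exp (-a) * a ^ (ν + d / 2 - 1) * (a + γ ^ 2) ^ (-(k : ℝ) - d / 2) := by
    rw [setIntegral_pos_iff_support_of_nonneg_ae _ (integrableOn_alphaCoeff hν hγ k)]
    · rw [inter_eq_right.2]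
      · simp
      · intro a (ha : 0 < a)
        exact (by positivity : 0 < exp (-a) * a ^ (ν + d / 2 - 1) *
          (a + γ ^ 2) ^ (-(k : ℝ) - d / 2)).ne'
    · filter_upwards [ae_restrict_mem measurableSet_Ioi] with a (ha : 0 < a)
      simp only [Pi.zero_apply]
      positivity
  unfold alphaCoeff
  positivity

lemma measurable_negBinomialPMFReal (r b : ℝ) (k : ℕ) :
    Measurable fun a : ℝ => negBinomialPMFReal r (a / (a + b)) k := by
  unfold negBinomialPMFReal
  fun_prop

lemma ofReal_alphaCoeff (hd : 1 ≤ d) (hν : 0 < ν) (hγ : 0 < γ) (k : ℕ) :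
    ENNReal.ofReal (alphaCoeff d ν γ k) =
      ∫⁻ a, ENNReal.ofReal (negBinomialPMFReal ((d : ℝ) / 2) (a / (a + γ ^ 2)) k)
        ∂(gammaMeasure ν 1) := by
  have hd' : (0 : ℝ) < d := by exact_mod_cast hd
  have hGν := Gamma_pos_of_pos hν
  have hGd : 0 < Gamma ((d : ℝ) / 2) := Gamma_pos_of_pos (by positivity)
  have hGk : 0 < Gamma ((k : ℝ) + d / 2) := Gamma_pos_of_pos (by positivity)
  have := measurable_negBinomialPMFReal ((d : ℝ) / 2) (γ ^ 2) k
  rw [lintegral_gammaMeasure_eq_setLIntegral (by fun_prop), alphaCoeff,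
    ENNReal.ofReal_mul (by positivity),
    ofReal_integral_eq_lintegral_ofReal (integrableOn_alphaCoeff hν hγ k),
    ← lintegral_const_mul' _ _ ENNReal.ofReal_ne_top]
  · refine setLIntegral_congr_fun measurableSet_Ioi fun a (ha : 0 < a) => ?_
    have hs : 0 < a + γ ^ 2 := by positivity
    rw [← ENNReal.ofReal_mul (by positivity), ← ENNReal.ofReal_mul (by positivity)]
    congr 1
    have h1 : 1 - a / (a + γ ^ 2) = γ ^ 2 / (a + γ ^ 2) := by field_simp; ring
    rw [negBinomialPMFReal_eq (by positivity), h1, div_rpow ha.le hs.le, div_pow, ← pow_mul,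
      one_rpow, one_mul, show ν + d / 2 - 1 = (ν - 1) + (d : ℝ) / 2 by ring, rpow_add ha,
      show -(k : ℝ) - d / 2 = -(k + (d : ℝ) / 2) by ring, rpow_neg hs.le, rpow_add hs,
      rpow_natCast]
    have : (a + γ ^ 2) ^ ((d : ℝ) / 2) ≠ 0 := by positivity
    field_simp
  · filter_upwards [ae_restrict_mem measurableSet_Ioi] with a (ha : 0 < a)
    simp only [Pi.zero_apply]
    positivity

lemma negBinomialMeasure_singleton (r p : ℝ) (k : ℕ) :
    negBinomialMeasure r p {k} = ENNReal.ofReal (negBinomialPMFReal r p k) := by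
  rw [negBinomialMeasure, Measure.sum_apply _ (measurableSet_singleton k), tsum_eq_single k]
  · simp
  · intro j hj
    simp [hj]

lemma compoundNegBinomial_singleton (hd : 1 ≤ d) (hν : 0 < ν) (hγ : 0 < γ) (k : ℕ) :
    compoundNegBinomial ((d : ℝ) / 2) ν (γ ^ 2) {k} = ENNReal.ofReal (alphaCoeff d ν γ k) := by
  rw [compoundNegBinomial, Measure.bind_apply (measurableSet_singleton k)
    (negBinomialKernel _).aemeasurable, lintegral_gammaMeasure_eq_one_rate (by positivity)
    ((negBinomialKernel _).measurable_coe (measurableSet_singleton k)),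
    ofReal_alphaCoeff hd hν hγ]
  refine lintegral_congr_ae ?_
  filter_upwards [ae_pos_gammaMeasure ν 1] with a ha
  have h : (γ ^ 2)⁻¹ * a / (1 + (γ ^ 2)⁻¹ * a) = a / (a + γ ^ 2) := by
    field_simp
    ring
  rw [← h]
  exact negBinomialMeasure_singleton _ _ k

lemma tsum_alphaCoeff (hd : 1 ≤ d) (hν : 0 < ν) (hγ : 0 < γ) :
    ∑' k, ENNReal.ofReal (alphaCoeff d ν γ k) = 1 := by
  have := isProbabilityMeasure_gammaMeasure hν one_pos
  have hm := measurable_negBinomialPMFReal ((d : ℝ) / 2) (γ ^ 2)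
  simp_rw [ofReal_alphaCoeff hd hν hγ]
  rw [← lintegral_tsum (fun k => (hm k).ennreal_ofReal.aemeasurable)]
  trans ∫⁻ _, 1 ∂(gammaMeasure ν 1)
  · refine lintegral_congr_ae ?_
    filter_upwards [ae_pos_gammaMeasure ν 1] with a ha
    exact tsum_negBinomial hd (by positivity)
      ((div_lt_one (by positivity)).2 (lt_add_of_pos_right a (by positivity)))
  · simp

lemma hasSum_alphaCoeff (hd : 1 ≤ d) (hν : 0 < ν) (hγ : 0 < γ) :
    HasSum (alphaCoeff d ν γ) 1 := by
  have hpos := fun k => (alphaCoeff_pos hd hν hγ k).le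
  have h := tsum_alphaCoeff hd hν hγ
  have hs := (ENNReal.summable_toReal (f := fun k => ENNReal.ofReal (alphaCoeff d ν γ k))
    (by simp [h])).hasSum
  rw [← ENNReal.tsum_toReal_eq (by simp), h] at hs
  simpa [ENNReal.toReal_ofReal (hpos _)] using hs

end AlphaCoeff

/-! ### The law of the sum as a mixture over dimensions -/

section Representation

variable {d : ℕ} {ν γ : ℝ}

lemma lintegral_studentMeasure_conv_precGaussian (hd : 1 ≤ d) (hν : 0 < ν) (hγ : 0 < γ)
    {f : EuclideanSpace ℝ (Fin d) → ℝ≥0∞} (hf : Measurable f) :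
    ∫⁻ x, f x ∂((studentMeasure d ν).conv (precGaussian d (γ ^ 2))) =
      ∑' k : ℕ, ENNReal.ofReal (alphaCoeff d ν γ k) *
        ∫⁻ u, (∫⁻ x, f (‖x‖ • u) ∂(precGaussian (2 * k + d) (γ ^ 2))) ∂(sphereUniform d) := by
  have hγ2 : 0 < γ ^ 2 := by positivity
  have := isProbabilityMeasure_precGaussian d hγ2
  have := fun k : ℕ => isProbabilityMeasure_precGaussian (2 * k + d) hγ2
  have hnb := fun k => (measurable_negBinomialPMFReal ((d : ℝ) / 2) (γ ^ 2) k).ennreal_ofReal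
  have hconv : Measurable fun x => ∫⁻ y, f (x + y) ∂(precGaussian d (γ ^ 2)) :=
    Measurable.lintegral_prod_right' (f := fun q => f (q.1 + q.2)) (by fun_prop)
  have hrad : ∀ k : ℕ, Measurable fun u =>
      ∫⁻ x, f (‖x‖ • u) ∂(precGaussian (2 * k + d) (γ ^ 2)) := fun k =>
    Measurable.lintegral_prod_right' (f := fun q : EuclideanSpace ℝ (Fin d) ×
      EuclideanSpace ℝ (Fin (2 * k + d)) => f (‖q.2‖ • q.1)) (by fun_prop)
  rw [Measure.lintegral_conv hf, lintegral_studentMeasure d hν hconv]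
  simp_rw [ofReal_alphaCoeff hd hν hγ, ← lintegral_mul_const _ (hnb _)]
  rw [← lintegral_tsum fun k => ((hnb k).mul_const _).aemeasurable]
  -- From here `a` is fixed, and the claim concerns a single Gaussian of parameter γ² p.
  refine lintegral_congr_ae ?_
  filter_upwards [ae_pos_gammaMeasure ν 1] with a ha
  have hp : 0 < a / (a + γ ^ 2) := by positivity
  have hp1 : a / (a + γ ^ 2) < 1 :=
    (div_lt_one (by positivity)).2 (lt_add_of_pos_right a hγ2)
  rw [← Measure.lintegral_conv hf, precGaussian_conv_precGaussian d ha hγ2,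
    lintegral_precGaussian_eq_norm_smul hd (by positivity) hf]
  simp_rw [← lintegral_const_mul' _ _ ENNReal.ofReal_ne_top]
  rw [← lintegral_tsum fun k => by
    simp_rw [lintegral_const_mul' _ _ ENNReal.ofReal_ne_top]
    exact ((hrad k).const_mul _).aemeasurable]
  refine lintegral_congr fun u => ?_
  simp_rw [lintegral_const_mul' _ _ ENNReal.ofReal_ne_top]
  exact (tsum_negBinomial_mul_lintegral_norm hd hγ2 hp hp1 (h := fun r => f (r • u))
    (by fun_prop)).symm

end Representation

/-! ### Evaluating a family of variables at a random index -/

section RandomIndex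

variable {Ω : Type*} [MeasurableSpace Ω] {Q : Measure Ω} {K : Ω → ℕ}

lemma aemeasurable_comp_random_index {E : Type*} [MeasurableSpace E] {F : ℕ → Ω → E}
    (hK : AEMeasurable K Q) (hF : ∀ k, AEMeasurable (F k) Q) :
    AEMeasurable (fun ω => F (K ω) ω) Q := by
  -- Each `F k` is replaced by a measurable version; the index set is countable, so the exceptional
  -- null sets have null union.
  refine ⟨fun ω => (hF (hK.mk K ω)).mk _ ω, ?_, ?_⟩
  · exact (measurable_from_prod_countable_right (f := fun q : ℕ × Ω => (hF q.1).mk _ q.2)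
      fun k => (hF k).measurable_mk).comp (hK.measurable_mk.prodMk measurable_id)
  · filter_upwards [hK.ae_eq_mk, ae_all_iff.2 fun k => (hF k).ae_eq_mk] with ω h1 h2
    rw [← h1, h2]

/-- Split over the events K = k and use independence on each. The target `E k` may vary with `k`, as
the dimension 2k + d does. -/
lemma lintegral_comp_random_index {E : ℕ → Type*} [∀ k, MeasurableSpace (E k)]
    {Z : (k : ℕ) → Ω → E k} {h : (k : ℕ) → E k → ℝ≥0∞}
    (hK : AEMeasurable K Q) (hZ : ∀ k, AEMeasurable (Z k) Q) (hh : ∀ k, Measurable (h k))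
    (hind : ∀ k, IndepFun K (Z k) Q) :
    ∫⁻ ω, h (K ω) (Z (K ω) ω) ∂Q =
      ∑' k, Q {ω | K ω = k} * ∫⁻ z, h k z ∂(Q.map (Z k)) := by
  let g : ℕ → ℕ → ℝ≥0∞ := fun k => ({k} : Set ℕ).indicator 1
  have hg : ∀ k, Measurable (g k) := fun k => measurable_from_top
  have hgK : ∀ k, AEMeasurable (fun ω => g k (K ω)) Q := fun k => (hg k).comp_aemeasurable hK
  have hhZ : ∀ k, AEMeasurable (fun ω => h k (Z k ω)) Q := fun k => (hh k).comp_aemeasurable (hZ k)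
  calc ∫⁻ ω, h (K ω) (Z (K ω) ω) ∂Q
      = ∫⁻ ω, ∑' k, g k (K ω) * h k (Z k ω) ∂Q := by
        refine lintegral_congr fun ω => ?_
        rw [tsum_eq_single (K ω) fun k hk => by simp [g, hk.symm]]
        simp [g]
    _ = ∑' k, ∫⁻ ω, g k (K ω) * h k (Z k ω) ∂Q :=
        lintegral_tsum fun k => (hgK k).mul (hhZ k)
    _ = _ := by
        refine tsum_congr fun k => ?_
        have := lintegral_mul_eq_lintegral_mul_lintegral_of_indepFun'' (hgK k) (hhZ k)
          ((hind k).comp (hg k) (hh k))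
        rw [this, lintegral_map' (hh k).aemeasurable (hZ k)]
        congr 1
        have hs : {ω | K ω = k} = K ⁻¹' {k} := rfl
        rw [hs, ← Measure.map_apply_of_aemeasurable hK (measurableSet_singleton k),
          ← lintegral_indicator_one (measurableSet_singleton k), lintegral_map' (hg k).aemeasurable hK]

end RandomIndex

lemma lintegral_smul_norm_smul {Ω : Type*} [MeasurableSpace Ω] {Q : Measure Ω}
    [IsProbabilityMeasure Q] {n d : ℕ} {σ : ℝ} (hσ : 0 < σ)
    {G : Ω → EuclideanSpace ℝ (Fin n)} {U : Ω → EuclideanSpace ℝ (Fin d)}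
    (hG : HasLaw G (stdGaussian (EuclideanSpace ℝ (Fin n))) Q)
    (hU : HasLaw U (sphereUniform d) Q) (hind : IndepFun G U Q)
    {f : EuclideanSpace ℝ (Fin d) → ℝ≥0∞} (hf : Measurable f) :
    ∫⁻ q, f ((σ * ‖q.1‖) • q.2) ∂(Q.map fun ω => (G ω, U ω)) =
      ∫⁻ u, (∫⁻ x, f (‖x‖ • u) ∂(precGaussian n (1 / (2 * σ ^ 2)))) ∂(sphereUniform d) := by
  have : IsProbabilityMeasure (sphereUniform d) := by
    rw [← hU.map_eq]
    exact Measure.isProbabilityMeasure_map hU.aemeasurable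
  rw [(indepFun_iff_map_prod_eq_prod_map_map hG.aemeasurable hU.aemeasurable).1 hind,
    hG.map_eq, hU.map_eq, lintegral_prod_symm' _ (by fun_prop)]
  refine lintegral_congr fun u => ?_
  rw [← isotropicGaussian_eq_precGaussian n hσ, isotropicGaussian,
    lintegral_map (by fun_prop) (by fun_prop)]
  simp only [norm_smul, norm_of_nonneg hσ.le]

end StudentGaussian

end

theorem mainTheorem3 (d : ℕ) (hd : 1 ≤ d) (ν σ γ : ℝ) (hν : 0 < ν) (hσ : 0 < σ)
    (hγ : γ = 1 / (σ * Real.sqrt 2)) :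
    -- the coefficients define a probability distribution on the nonnegative integers
    (∀ k : ℕ, 0 < StudentGaussian.alphaCoeff d ν γ k) ∧
    HasSum (StudentGaussian.alphaCoeff d ν γ) 1 ∧
    -- which is the compound negative binomial distribution
    (∀ k : ℕ, StudentGaussian.compoundNegBinomial ((d : ℝ) / 2) ν (γ ^ 2) {k} =
      ENNReal.ofReal (StudentGaussian.alphaCoeff d ν γ k)) ∧
    -- a random variable `K` with these probabilities has the compound law, and
    -- `X + T` is distributed as `σ ‖X_{2K+d}‖ U_d`
    ∀ (Ω : Type u) [MeasurableSpace Ω] (P : Measure Ω) [IsProbabilityMeasure P]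
      (X T : Ω → EuclideanSpace ℝ (Fin d))
      (_ : HasLaw X (StudentGaussian.isotropicGaussian d σ) P)
      (_ : HasLaw T (StudentGaussian.studentMeasure d ν) P)
      (_ : IndepFun X T P)
      (Ω' : Type v) [MeasurableSpace Ω'] (Q : Measure Ω') [IsProbabilityMeasure Q]
      (K : Ω' → ℕ) (U : Ω' → EuclideanSpace ℝ (Fin d))
      (G : (k : ℕ) → Ω' → EuclideanSpace ℝ (Fin (2 * k + d)))
      (_ : AEMeasurable K Q)
      (_ : ∀ k : ℕ, Q {ω | K ω = k} = ENNReal.ofReal (StudentGaussian.alphaCoeff d ν γ k))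
      (_ : HasLaw U (StudentGaussian.sphereUniform d) Q)
      (_ : ∀ k : ℕ, HasLaw (G k) (stdGaussian (EuclideanSpace ℝ (Fin (2 * k + d)))) Q)
      (_ : ∀ k : ℕ, IndepFun (G k) U Q)
      (_ : ∀ k : ℕ, IndepFun K (fun ω => (G k ω, U ω)) Q),
      HasLaw K (StudentGaussian.compoundNegBinomial ((d : ℝ) / 2) ν (γ ^ 2)) Q ∧
      IdentDistrib (fun ω => X ω + T ω) (fun ω => (σ * ‖G (K ω) ω‖) • U ω) P Q := by
  open StudentGaussian in
  have hγ0 : 0 < γ := by rw [hγ]; positivity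
  have hγσ : 1 / (2 * σ ^ 2) = γ ^ 2 := by
    rw [hγ, div_pow, mul_pow, Real.sq_sqrt zero_le_two]
    ring
  have hcomp := fun k => compoundNegBinomial_singleton hd hν hγ0 k
  refine ⟨fun k => alphaCoeff_pos hd hν hγ0 k, hasSum_alphaCoeff hd hν hγ0, hcomp, ?_⟩
  intro Ω _ P _ X T hX hT hXT Ω' _ Q _ K U G hK hKlaw hU hG hGU hKGU
  refine ⟨⟨hK, ?_⟩, ?_⟩
  -- A measure on ℕ is determined by its point masses.
  · refine Measure.ext_of_singleton fun k => ?_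
    rw [Measure.map_apply_of_aemeasurable hK (measurableSet_singleton k), hcomp, ← hKlaw]
    rfl
  have hY : AEMeasurable (fun ω => (σ * ‖G (K ω) ω‖) • U ω) Q :=
    aemeasurable_comp_random_index (F := fun k ω => (σ * ‖G k ω‖) • U ω) hK fun k =>
      ((hG k).aemeasurable.norm.const_mul σ).smul hU.aemeasurable
  refine ⟨hX.aemeasurable.add hT.aemeasurable, hY, ?_⟩
  have hsum : P.map (fun ω => X ω + T ω) =
      (studentMeasure d ν).conv (precGaussian d (γ ^ 2)) := by
    rw [← hγσ, ← isotropicGaussian_eq_precGaussian d hσ, ← hX.map_eq, ← hT.map_eq,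
      ← hXT.symm.map_add_eq_map_conv_map₀ hT.aemeasurable hX.aemeasurable]
    simp only [add_comm, Pi.add_def]
  rw [hsum]
  refine Measure.ext_of_lintegral _ fun f hf => ?_
  -- Both sides become series over `k` with weights α_k, compared term by term.
  rw [lintegral_studentMeasure_conv_precGaussian hd hν hγ0 hf,
    lintegral_map' hf.aemeasurable hY,
    lintegral_comp_random_index (Z := fun k ω => (G k ω, U ω))
      (h := fun k q => f ((σ * ‖q.1‖) • q.2)) hK
      (fun k => (hG k).aemeasurable.prodMk hU.aemeasurable) (fun k => by fun_prop) hKGU]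
  refine tsum_congr fun k => ?_
  rw [hKlaw, lintegral_smul_norm_smul hσ (hG k) hU (hGU k) hf, hγσ]
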